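/- **Setting.** Partitions $\lambda=(\lambda_1\ge\lambda_2\ge\cdots\ge\lambda_l>0)$ are extended by $\lambda_i=0$ for $i>l$, where $l$ is the length. A $B_n$ (resp. $D_n$) partition is a partition of $2n+1$ (resp. $2n$) in which every even integer appears an even number of times; a $C_n$ partition is a partition of $2n$ in which every odd integer appears an even number of times. It is *rigid* if $\lambda_i-\lambda_{i+1}\le 1$ for all $i$ and no odd integer (types $B,D$), respectively no even positive integer (type $C$), appears exactly twice. A *rigid semisimple operator* of the $B_n$ (resp. $C_n$, $D_n$) theory is a pair $(\lambda',\lambda'')$, where for some $k+m=n$, $\lambda'$ is a rigid $B_k$ (resp. $C_k$, $D_k$) partition and $\lambda''$ a rigid $D_m$ (resp. $C_m$, $D_m$) partition; empty partitions are allowed for types $C$ and $D$. **Symbol.** For a decreasing sequence $\lambda_1\ge\dots\ge\lambda_l\ge0$, list the odd terms of the sequence $l-k+\lambda_k$ $(1\le k\le l)$ increasingly as $2f_i+1$ and the even ones increasingly as $2g_i$, and put $\alpha_i=f_i-i+1$, $\beta_i=g_i-i+1$. The symbol is the array with top row $(\alpha_1,\alpha_2,\dots)$ and bottom row $(\beta_1,\beta_2,\dots)$.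 - $B_n$: this is the symbol of the partition. - $C_n$: if $l$ is even, compute as for $B_n$ and add a $0$ on the left of the top row; if $l$ is odd, first append a last part $0$, compute as for $B_n$, and delete the first entry (a $0$) of the bottom row. - $D_n$: append a last part $0$, compute as for $B_n$, and delete the first two entries (both $0$) of the bottom row; the symbol of the empty partition is the empty array. The symbol of $(\lambda',\lambda'')$ is the sum of the symbols of $\lambda'$ and $\lambda''$, where the top rows, and likewise the bottom rows, are aligned at their right ends, padded by zeros on the left, and added entrywise. **Fingerprint.** Let $\lambda=\lambda'+\lambda''$ (partwise), $p_\lambda(i)=(-1)^{\lambda_1+\cdots+\lambda_i}$, and $$\mu_i=\begin{cases}\lambda_i+p_\lambda(i)&\text{if }\lambda_i\text{ is odd and }\lambda_i\ne\lambda_{i-p_\lambda(i)},\\ \lambda_i&\text{otherwise.}\end{cases}$$ For an even positive integer $m$ put $\tau(m)=-1$ if there is an $i$ with $\mu_i=m$ satisfying at least one of: (i) $\mu_i\ne\lambda_i$; (ii) $\sum_{k\le i}\mu_k\ne\sum_{k\le i}\lambda_k$; (iii) $\lambda'_i$ is odd (types $B,D$), respectively $\lambda'_i$ is even (type $C$).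 Put $\tau(m)=1$ for all other positive integers $m$, in particular for all odd $m$. The fingerprint is the pair of partitions $[\alpha;\beta]$, where $\alpha$ has one part $a$ for each pair of parts of $\mu$ equal to $a$ with $\tau(a)=1$, and $\beta$ has one part $b$ for each part of $\mu$ equal to $2b$ with $\tau(2b)=-1$. **Theorem.** Let $n\ge0$, and consider the $B_n$, the $C_n$ or the $D_n$ theory. If two rigid semisimple operators of this theory have the same symbol, then they have the same fingerprint. -/

import Mathlib

namespace RigidOp

/-- The theories with gauge algebra of type `B_n`, `C_n`, `D_n`. -/
inductive Theory where
  | B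
  | C
  | D

/-- The number of boxes of a partition of rank `n`: `2n+1` in the `B_n` theory, `2n` in the `C_n`
and `D_n` theories. -/
def Theory.boxes : Theory → ℕ → ℕ
  | .B, n => 2 * n + 1
  | .C, n => 2 * n
  | .D, n => 2 * n

/-- The theory to which the second partition of a semisimple operator belongs, corresponding to
`so(2k+1) × so(2l)`, `sp(2k) × sp(2l)` and `so(2k) × so(2l)`. -/
def Theory.second : Theory → Theory
  | .B => .D
  | .C => .C
  | .D => .D

/-- The parts of a partition, in decreasing order. -/
def rows {N : ℕ} (p : Nat.Partition N) : List ℕ :=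
  p.parts.sort (fun a b => a ≥ b)

/-- The parts of a partition, in decreasing order and extended by zeros. The index starts at `0`,
so `part p i` is the part usually written with the subscript `i + 1`. -/
def part {N : ℕ} (p : Nat.Partition N) (i : ℕ) : ℕ :=
  (rows p).getD i 0

/-- In the `B_n` and `D_n` theories all even integers appear an even number of times in a partition,
in the `C_n` theory all odd integers do. -/
def IsTheoryPartition {N : ℕ} (t : Theory) (p : Nat.Partition N) : Prop :=
  match t with
  | .B => ∀ m, Even m → Even (p.parts.count m)
  | .C => ∀ m, Odd m → Even (p.parts.count m)
  | .D => ∀ m, Even m → Even (p.parts.count m)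

/-- A rigid partition: there are no gaps (the smallest part is `1`, as the parts are extended by
zeros), and no odd (`B_n`, `D_n`), respectively even (`C_n`), integer appears exactly twice. -/
structure IsRigid {N : ℕ} (t : Theory) (p : Nat.Partition N) : Prop where
  isTheoryPartition : IsTheoryPartition t p
  no_gaps : ∀ i, part p i ≤ part p (i + 1) + 1
  not_twice : match t with
    | .B => ∀ m, Odd m → p.parts.count m ≠ 2
    | .C => ∀ m, Even m → p.parts.count m ≠ 2
    | .D => ∀ m, Odd m → p.parts.count m ≠ 2

/-- A rigid semisimple operator of rank `n`, given by its pair of rigid partitions. Either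
partition may be empty when its type allows it (rigid unipotent operators are included). -/
structure RigidSemisimpleOperator (t : Theory) (n : ℕ) where
  k : ℕ
  l : ℕ
  rank_eq : k + l = n
  fst : Nat.Partition (t.boxes k)
  snd : Nat.Partition (t.second.boxes l)
  fst_rigid : IsRigid t fst
  snd_rigid : IsRigid t.second snd

/-! ### The symbol -/

/-- A symbol: an array with a top row `α₁, α₂, …` and a bottom row `β₁, β₂, …`. -/
@[ext]
structure Symbol where
  top : List ℤ
  bottom : List ℤ

/-- The sequence obtained from `a₁ ≥ ⋯ ≥ a_l` by adding `l - k` to the `k`th term (the index in the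
code starts at `0`). -/
def shifted (a : List ℕ) : List ℕ :=
  a.mapIdx fun k x => x + (a.length - (k + 1))

/-- The numbers `f₁ < f₂ < ⋯`, where the odd terms of the shifted sequence are `2 fᵢ + 1`. -/
def oddHalves (a : List ℕ) : List ℕ :=
  (((shifted a).filter fun x => x % 2 = 1).map fun x => x / 2).insertionSort (fun x y => x ≤ y)

/-- The numbers `g₁ < g₂ < ⋯`, where the even terms of the shifted sequence are `2 gᵢ`. -/
def evenHalves (a : List ℕ) : List ℕ :=
  (((shifted a).filter fun x => x % 2 = 0).map fun x => x / 2).insertionSort (fun x y => x ≤ y)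

/-- From `f₁, f₂, …` to `f₁ - 1 + 1, f₂ - 2 + 1, …` (the index in the code starts at `0`). -/
def unshift (f : List ℕ) : List ℤ :=
  f.mapIdx fun i x => (x : ℤ) - (i : ℤ)

/-- The symbol of a decreasing sequence by the `B_n` rule. -/
def symbolB (a : List ℕ) : Symbol where
  top := unshift (oddHalves a)
  bottom := unshift (evenHalves a)

/-- The symbol of a sequence of even length by the `B_n` rule followed by appending a `0` on the left
of the top row; for a sequence of odd length, a last part `0` is appended first, and the first entry
of the bottom row (a `0`) is deleted. -/
def symbolC (a : List ℕ) : Symbol :=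
  if Even a.length then
    { top := 0 :: (symbolB a).top, bottom := (symbolB a).bottom }
  else
    { top := (symbolB (a ++ [0])).top, bottom := (symbolB (a ++ [0])).bottom.drop 1 }

/-- A last part `0` is appended, the `B_n` rule is applied, and the first two entries of the
bottom row (two `0`s) are deleted. The symbol of the empty partition is the empty array. -/
def symbolD (a : List ℕ) : Symbol where
  top := (symbolB (a ++ [0])).top
  bottom := (symbolB (a ++ [0])).bottom.drop 2

/-- The symbol of a partition. -/
def partitionSymbol {N : ℕ} (t : Theory) (p : Nat.Partition N) : Symbol :=
  match t with
  | .B => symbolB (rows p)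
  | .C => symbolC (rows p)
  | .D => symbolD (rows p)

/-- Entrywise sum of two rows aligned at their right ends; the shorter row is padded by zeros on
the left. -/
def addRight (a b : List ℤ) : List ℤ :=
  List.zipWith (fun x y => x + y)
    (a.leftpad (max a.length b.length) 0) (b.leftpad (max a.length b.length) 0)

/-- The symbol of a rigid semisimple operator. -/
def RigidSemisimpleOperator.symbol {t : Theory} {n : ℕ} (x : RigidSemisimpleOperator t n) :
    Symbol where
  top := addRight (partitionSymbol t x.fst).top (partitionSymbol t.second x.snd).top
  bottom := addRight (partitionSymbol t x.fst).bottom (partitionSymbol t.second x.snd).bottom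

/-! ### The fingerprint -/

/-- `p_a(i) = (-1) ^ (a₀ + ⋯ + aᵢ)`. -/
def sign (a : ℕ → ℕ) (i : ℕ) : ℤ :=
  (-1) ^ (∑ j ∈ Finset.range (i + 1), a j)

/-- The sequence `μ = Sp(a)`: the term `aᵢ` is replaced by `aᵢ + p_a(i)` if it is odd and differs
from the term with index `i - p_a(i)`. (For `i = 0` and `a₀` odd the sign is `-1`, so `a (i - 1)` is
only consulted for positive `i`; and `aᵢ - 1` is only formed for odd `aᵢ`.) -/
def spMap (a : ℕ → ℕ) (i : ℕ) : ℕ :=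
  if sign a i = 1 then
    if Odd (a i) ∧ a i ≠ a (i - 1) then a i + 1 else a i
  else
    if Odd (a i) ∧ a i ≠ a (i + 1) then a i - 1 else a i

namespace RigidSemisimpleOperator

variable {t : Theory} {n : ℕ}

/-- The sum of the two partitions. -/
def sumPart (x : RigidSemisimpleOperator t n) (i : ℕ) : ℕ :=
  part x.fst i + part x.snd i

/-- The sequence `μ`. -/
def mu (x : RigidSemisimpleOperator t n) (i : ℕ) : ℕ :=
  spMap x.sumPart i

/-- The number of parts of the sum of the two partitions. -/
def length (x : RigidSemisimpleOperator t n) : ℕ :=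
  max (rows x.fst).length (rows x.snd).length

/-- Condition (iii): the part of the first partition is odd (`B_n`, `D_n`), respectively even
(`C_n`). -/
def parityCondition (x : RigidSemisimpleOperator t n) (i : ℕ) : Prop :=
  match t with
  | .B => Odd (part x.fst i)
  | .C => Even (part x.fst i)
  | .D => Odd (part x.fst i)

/-- One of the conditions (i), (ii), (iii) holds at the index `i`. -/
def condition (x : RigidSemisimpleOperator t n) (i : ℕ) : Prop :=
  x.mu i ≠ x.sumPart i ∨
    (∑ j ∈ Finset.range (i + 1), x.mu j ≠ ∑ j ∈ Finset.range (i + 1), x.sumPart j) ∨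
    x.parityCondition i

open scoped Classical in
/-- The sign `τ(m)` of a positive integer; it is `1` for odd `m`. -/
noncomputable def tau (x : RigidSemisimpleOperator t n) (m : ℕ) : ℤ :=
  if Even m ∧ ∃ i < x.length, x.mu i = m ∧ x.condition i then -1 else 1

/-- The multiset of the (positive) parts of `μ`. -/
def muParts (x : RigidSemisimpleOperator t n) : Multiset ℕ :=
  ((Multiset.range x.length).map x.mu).filter fun a => 0 < a

/-- One part `a` for each pair of parts of `μ` equal to `a` with `τ(a) = 1`. -/
noncomputable def alpha (x : RigidSemisimpleOperator t n) : Multiset ℕ :=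
  ∑ a ∈ x.muParts.toFinset.filter (fun a => x.tau a = 1),
    Multiset.replicate (x.muParts.count a / 2) a

/-- One part `b` for each part `2b` of `μ` with `τ(2b) = -1`. -/
noncomputable def beta (x : RigidSemisimpleOperator t n) : Multiset ℕ :=
  (x.muParts.filter fun a => x.tau a = -1).map fun a => a / 2

/-- The fingerprint `[α; β]`, a pair of partitions given by their multisets of parts. -/
noncomputable def fingerprint (x : RigidSemisimpleOperator t n) : Multiset ℕ × Multiset ℕ :=
  (x.alpha, x.beta)

end RigidSemisimpleOperator

end RigidOp

namespace RigidOp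

open Finset

/-! ### The map `spMap` -/

/-! The symbol and the fingerprint are both read off one integer sequence, `heights`:
$u_i=\lambda_i+e_i$, where $e_i$ is the sum of the two values `pairSign` at $i$. In each of the two
partitions the terms of one parity come in pairs of equal neighbours, marked $-1,+1$; the other
terms are marked $0$.

The symbol determines $u$. Read from the right, top and bottom entries alternate in the index, and
twice the entry at $i$ is $\lambda_i$ plus its mark plus $\delta(-1)^i$, with $\delta$ depending
only on the type (`IsRigid.symbol_formula`). Addition aligned at the right therefore adds these
formulas (`heights_eq`).

$u$ determines the fingerprint. If $\lambda_i$ is odd, exactly one of its summands is paired and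
$e_i=p_\lambda(i)$; if $\lambda_i$ is even, $e_i\in\{-2,0,2\}$. An ascent of $u$ occurs only at
equal neighbours $c,c$ with heights $c-1,c+1$ or $c-2,c+2$, so replacing each ascending pair by its
mean gives $\mu$ (`IsCorrection.spMap_eq`). Where $\mu_i$ is even, one of (i)–(iii) holds exactly
when $i$ lies in no ascending pair (`IsCorrection.condition_iff`). -/

theorem sign_eq_or (c : ℕ → ℕ) (i : ℕ) : sign c i = 1 ∨ sign c i = -1 :=
  neg_one_pow_eq_or ℤ _

theorem sign_zero (c : ℕ → ℕ) : sign c 0 = (-1) ^ c 0 := by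
  simp [sign]

theorem sign_succ (c : ℕ → ℕ) (i : ℕ) : sign c (i + 1) = sign c i * (-1) ^ c (i + 1) := by
  simp only [sign]
  rw [sum_range_succ _ (i + 1), pow_add]

theorem sign_succ_of_even {c : ℕ → ℕ} {i : ℕ} (h : Even (c (i + 1))) :
    sign c (i + 1) = sign c i := by
  rw [sign_succ, h.neg_one_pow, mul_one]

theorem sign_succ_of_odd {c : ℕ → ℕ} {i : ℕ} (h : Odd (c (i + 1))) :
    sign c (i + 1) = -sign c i := by
  rw [sign_succ, h.neg_one_pow, mul_neg_one]

/-- The partial sums of `spMap c` and of `c` differ by at most one. -/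
theorem sum_spMap (c : ℕ → ℕ) (i : ℕ) :
    (∑ j ∈ range (i + 1), (spMap c j : ℤ)) = ∑ j ∈ range (i + 1), (c j : ℤ) +
      if sign c i = -1 ∧ ¬(Odd (c i) ∧ c i = c (i + 1)) then -1 else 0 := by
  induction i with
  | zero =>
    rcases Nat.even_or_odd (c 0) with h | h
    · simp [spMap, sign_zero, h.neg_one_pow, Nat.not_odd_iff_even.2 h]
    · have := h.pos
      by_cases h1 : c 0 = c 1
      · simp [spMap, sign_zero, h1 ▸ h, (h1 ▸ h : Odd (c 1)).neg_one_pow, h1]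
      · simp [spMap, sign_zero, h.neg_one_pow, h, h1]
        omega
  | succ i ih =>
    rw [sum_range_succ _ (i + 1), ih, sum_range_succ _ (i + 1)]
    rcases Nat.even_or_odd (c (i + 1)) with h | h
    · have h1 : ¬Odd (c (i + 1)) := Nat.not_odd_iff_even.2 h
      have h2 : ¬(Odd (c i) ∧ c i = c (i + 1)) := fun h3 => h1 (h3.2 ▸ h3.1)
      simp only [spMap, sign_succ_of_even h, h1, h2, false_and, if_false, ite_self]
      ring
    · have hp := h.pos
      rcases sign_eq_or c i with hs | hs
      · by_cases h2 : c (i + 1) = c (i + 2)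
        · simp [spMap, sign_succ_of_odd h, hs, ← h2, h]
        · simp [spMap, sign_succ_of_odd h, hs, h, h2]
          omega
      · by_cases h2 : c i = c (i + 1)
        · simp [spMap, sign_succ_of_odd h, hs, h2, h]
        · simp [spMap, sign_succ_of_odd h, hs, h2, Ne.symm h2, h]
          ring

theorem spMap_of_even {c : ℕ → ℕ} {i : ℕ} (hi : Even (c i)) : spMap c i = c i := by
  simp [spMap, Nat.not_odd_iff_even.2 hi]

/-! ### Recovering `spMap` from shifted heights -/

/-- A correction `e` of a decreasing sequence `c`, for which `c + e` determines `spMap c`. -/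
structure IsCorrection (c : ℕ → ℕ) (e : ℕ → ℤ) : Prop where
  antitone : Antitone c
  of_odd : ∀ i, Odd (c i) → e i = sign c i
  of_even : ∀ i, Even (c i) → e i = -2 ∨ e i = 0 ∨ e i = 2
  next : ∀ i, e i = -2 → e (i + 1) = 2 ∧ c (i + 1) = c i
  prev : ∀ i, e i = 2 → ∃ j, i = j + 1 ∧ e j = -2 ∧ c j = c i

/-- The sequence recovered from the heights `u`: two heights in increasing order are replaced by
their mean. -/
def meanMap (u : ℕ → ℤ) (i : ℕ) : ℤ :=
  if u i < u (i + 1) then (u i + u (i + 1)) / 2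
  else if 0 < i ∧ u (i - 1) < u i then (u (i - 1) + u i) / 2
  else u i

/-- The index `i` belongs to no pair of consecutive heights in increasing order. -/
def IsIsolated (u : ℕ → ℤ) (i : ℕ) : Prop :=
  ¬u i < u (i + 1) ∧ ¬(0 < i ∧ u (i - 1) < u i)

namespace IsCorrection

variable {c : ℕ → ℕ} {e : ℕ → ℤ}

theorem cases (h : IsCorrection c e) (i : ℕ) :
    (Odd (c i) ∧ sign c i = e i ∧ (e i = 1 ∨ e i = -1)) ∨
    (Even (c i) ∧ (e i = -2 ∨ e i = 0 ∨ e i = 2)) := by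
  rcases Nat.even_or_odd (c i) with h1 | h1
  · exact Or.inr ⟨h1, h.of_even i h1⟩
  · have := h.of_odd i h1
    exact Or.inl ⟨h1, this.symm, this ▸ sign_eq_or c i⟩

/-- A descent of `c` outweighs any rise of `e`: the values `-2` and `2` occur only next to each
other over equal terms, and parity bounds the rise in the remaining cases. -/
theorem lt_iff (h : IsCorrection c e) (i : ℕ) : (c i + e i < c (i + 1) + e (i + 1)) ↔
    c (i + 1) = c i ∧ (e i = -1 ∧ e (i + 1) = 1 ∨ e i = -2 ∧ e (i + 1) = 2) := by
  constructor
  · intro hlt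
    have ha := h.antitone (Nat.le_succ i)
    have hn := h.next i
    have hp : e (i + 1) = 2 → e i = -2 ∧ c i = c (i + 1) := by
      intro h2
      obtain ⟨j, hj, h3⟩ := h.prev _ h2
      obtain rfl : i = j := by omega
      exact h3
    simp only [Nat.succ_eq_add_one] at ha
    rcases h.cases i with ⟨⟨k, hk⟩, -, h1⟩ | ⟨⟨k, hk⟩, h1⟩ <;>
      rcases h.cases (i + 1) with ⟨⟨k', hk'⟩, -, h2⟩ | ⟨⟨k', hk'⟩, h2⟩ <;> omega
  · omega

theorem neg_one_of_odd_eq (h : IsCorrection c e) {i : ℕ} (ho : Odd (c i)) (he : c (i + 1) = c i) :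
    (e i = -1 ↔ e (i + 1) = 1) := by
  have h1 := h.of_odd i ho
  have h2 := h.of_odd (i + 1) (he ▸ ho)
  rw [sign_succ_of_odd (he ▸ ho)] at h2
  omega

theorem prev_iff (h : IsCorrection c e) (i : ℕ) :
    (0 < i ∧ c (i - 1) + e (i - 1) < c i + e i) ↔
    0 < i ∧ c i = c (i - 1) ∧ (e (i - 1) = -1 ∧ e i = 1 ∨ e (i - 1) = -2 ∧ e i = 2) := by
  rcases i with _ | j
  · simp
  · simp [h.lt_iff j]

theorem spMap_of_one (h : IsCorrection c e) {i : ℕ} (ho : Odd (c i)) (he : e i = 1) :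
    0 < i ∧ spMap c i = if c i = c (i - 1) then c i else c i + 1 := by
  have hs := h.of_odd i ho
  refine ⟨Nat.pos_of_ne_zero ?_, ?_⟩
  -- An odd term at index `0` has sign `-1`.
  · rintro rfl
    rw [sign_zero, ho.neg_one_pow] at hs
    omega
  · by_cases h1 : c i = c (i - 1)
    · simp [spMap, ← h1, ← hs, he]
    · simp [spMap, ho, h1, ← hs, he]

theorem spMap_of_neg_one (h : IsCorrection c e) {i : ℕ} (ho : Odd (c i)) (he : e i = -1) :
    spMap c i = if c (i + 1) = c i then c i else c i - 1 := by
  have hs := h.of_odd i ho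
  by_cases h1 : c (i + 1) = c i
  · simp [spMap, h1, ← hs, he]
  · simp [spMap, ho, h1, ← hs, he, Ne.symm h1]

/-- An odd term keeps its value under `spMap` exactly when the neighbour its sign points to is
equal, and that neighbour then completes an ascending pair. An even term is in such a pair exactly
when its correction is `±2`. -/
theorem isIsolated_iff (h : IsCorrection c e) (i : ℕ) : IsIsolated (fun i => c i + e i) i ↔
    (Even (c i) ∧ e i = 0) ∨ (Odd (c i) ∧ spMap c i ≠ c i) := by
  simp only [IsIsolated, h.prev_iff, h.lt_iff]
  rcases h.cases i with ⟨ho, -, h1 | h1⟩ | ⟨hi, h1⟩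
  · obtain ⟨h2, h3⟩ := h.spMap_of_one ho h1
    obtain ⟨j, rfl⟩ : ∃ j, i = j + 1 := ⟨i - 1, by omega⟩
    simp only [Nat.add_sub_cancel] at *
    have h4 : c (j + 1) = c j → e j = -1 := fun h5 =>
      (h.neg_one_of_odd_eq (h5 ▸ ho) h5).2 h1
    have h6 := Nat.not_even_iff_odd.2 ho
    simp only [h3, h1, ho, h6]
    split_ifs <;> simp <;> omega
  · have h3 := h.spMap_of_neg_one ho h1
    have h4 : c (i + 1) = c i → e (i + 1) = 1 := fun h5 =>
      (h.neg_one_of_odd_eq ho h5).1 h1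
    have h6 := Nat.not_even_iff_odd.2 ho
    have := ho.pos
    simp only [h3, h1, ho, h6]
    split_ifs <;> simp <;> omega
  · have h2 := Nat.not_odd_iff_even.2 hi
    simp only [hi, h2, true_and, false_and, or_false]
    have hn := h.next i
    have hp : e i = 2 → 0 < i ∧ c i = c (i - 1) ∧ e (i - 1) = -2 := by
      intro h3
      obtain ⟨j, rfl, h4⟩ := h.prev i h3
      exact ⟨by omega, h4.2.symm, h4.1⟩
    omega

theorem spMap_eq (h : IsCorrection c e) (i : ℕ) :
    (spMap c i : ℤ) = meanMap (fun i => c i + e i) i := by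
  have hiso := h.isIsolated_iff i
  simp only [IsIsolated, h.prev_iff, h.lt_iff] at hiso
  simp only [meanMap, h.prev_iff, h.lt_iff]
  rcases h.cases i with ⟨ho, -, h1 | h1⟩ | ⟨hi, h1⟩
  · have h6 := Nat.not_even_iff_odd.2 ho
    obtain ⟨h2, h3⟩ := h.spMap_of_one ho h1
    simp only [ho, h6, false_and, true_and, false_or] at hiso
    split_ifs at h3 ⊢ <;> omega
  · have h6 := Nat.not_even_iff_odd.2 ho
    have h3 := h.spMap_of_neg_one ho h1
    have := ho.pos
    simp only [ho, h6, false_and, true_and, false_or] at hiso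
    split_ifs at h3 ⊢ <;> omega
  · have h2 := Nat.not_odd_iff_even.2 hi
    simp only [hi, h2, true_and, false_and, or_false] at hiso
    rw [spMap_of_even hi]
    split_ifs <;> omega

/-- If the conditions (ii), (iii) fail at the even terms exactly where the correction is `±2`, then
all three conditions fail exactly in the pairs of consecutive heights in increasing order. -/
theorem condition_iff (h : IsCorrection c e) {r : ℕ → Prop}
    (hr : ∀ i, Even (c i) → (e i = 0 ↔ sign c i = -1 ∨ r i))
    {i : ℕ} (hm : Even (spMap c i)) :
    (spMap c i ≠ c i ∨
      (∑ j ∈ range (i + 1), spMap c j ≠ ∑ j ∈ range (i + 1), c j) ∨ r i) ↔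
      IsIsolated (fun i => c i + e i) i := by
  rw [h.isIsolated_iff]
  rcases Nat.even_or_odd (c i) with h1 | h1
  · have h2 : ¬Odd (c i) := Nat.not_odd_iff_even.2 h1
    have h3 : spMap c i = c i := by simp [spMap, h2]
    -- At an even term the exceptional case of `sum_spMap` cannot occur, so the sign alone decides
    -- (ii).
    have h4 : (∑ j ∈ range (i + 1), spMap c j = ∑ j ∈ range (i + 1), c j) ↔ ¬sign c i = -1 := by
      have := sum_spMap c i
      zify
      rw [this]
      simp [h2]
    simp [h1, h2, h3, hr i h1, h4]
  · have h3 : spMap c i ≠ c i := fun h4 => Nat.not_even_iff_odd.2 h1 (h4 ▸ hm)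
    simp [h1, h3]

end IsCorrection

/-! ### Rows of the symbol, read from the right -/

theorem insertionSort_map_half_eq_reverse {l : List ℕ} (h : l.Pairwise (· > ·)) :
    (l.map fun x => x / 2).insertionSort (fun x y => x ≤ y) = (l.map fun x => x / 2).reverse := by
  refine ((List.perm_insertionSort _ _).trans (List.reverse_perm _).symm).eq_of_pairwise'
    (List.pairwise_insertionSort _ _) ?_
  rw [List.pairwise_reverse, List.pairwise_map]
  exact h.imp fun hxy => Nat.div_le_div_right hxy.le

theorem unshift_append_singleton (f : List ℕ) (x : ℕ) :
    unshift (f ++ [x]) = unshift f ++ [(x : ℤ) - f.length] := by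
  simp [unshift, List.mapIdx_append]

theorem length_unshift (f : List ℕ) : (unshift f).length = f.length := by
  simp [unshift]

theorem shifted_cons (x : ℕ) (t : List ℕ) : shifted (x :: t) = (x + t.length) :: shifted t := by
  simp [shifted, List.mapIdx_cons]

theorem length_shifted (t : List ℕ) : (shifted t).length = t.length := by
  simp [shifted]

theorem lt_of_mem_shifted {t : List ℕ} {x : ℕ} (h : ∀ y ∈ t, y ≤ x) :
    ∀ z ∈ shifted t, z < x + t.length := by
  induction t with
  | nil => simp [shifted]
  | cons y t ih =>
    have h1 := h y (by simp)
    have h2 := ih fun z hz => h z (by simp [hz])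
    intro z hz
    rw [shifted_cons, List.mem_cons] at hz
    rcases hz with rfl | hz
    · simp; omega
    · have := h2 z hz
      simp; omega

theorem pairwise_shifted {t : List ℕ} (h : t.Pairwise (· ≥ ·)) :
    (shifted t).Pairwise (· > ·) := by
  induction t with
  | nil => simp [shifted]
  | cons x t ih =>
    rw [List.pairwise_cons] at h
    rw [shifted_cons, List.pairwise_cons]
    exact ⟨lt_of_mem_shifted h.1, ih h.2⟩

/-- The top row of the symbol of a decreasing sequence, read from the right. -/
def revTop (a : List ℕ) : List ℤ := (symbolB a).top.reverse

/-- The bottom row of the symbol of a decreasing sequence, read from the right. -/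
def revBottom (a : List ℕ) : List ℤ := (symbolB a).bottom.reverse

theorem revTop_nil : revTop [] = [] := rfl

theorem revBottom_nil : revBottom [] = [] := rfl

section Cons

variable {x : ℕ} {t : List ℕ}

/-- The head gives the largest shifted value, hence the rightmost entry of its row. Its rank there
is the number of entries already present, and these do not change. -/
theorem revTop_cons_of_odd (h : (x :: t).Pairwise (· ≥ ·)) (ho : Odd (x + t.length)) :
    revTop (x :: t) = (((x + t.length) / 2 : ℕ) - (revTop t).length : ℤ) :: revTop t := by
  have h1 := (pairwise_shifted h).filter fun x => decide (x % 2 = 1)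
  have h2 := (pairwise_shifted h.of_cons).filter fun x => decide (x % 2 = 1)
  have ho' := Nat.odd_iff.1 ho
  simp only [revTop, symbolB, oddHalves]
  rw [insertionSort_map_half_eq_reverse h1, insertionSort_map_half_eq_reverse h2, shifted_cons,
    List.filter_cons_of_pos (by simpa using ho'), List.map_cons, List.reverse_cons,
    unshift_append_singleton]
  simp [length_unshift]

theorem revTop_cons_of_even (he : Even (x + t.length)) :
    revTop (x :: t) = revTop t := by
  have he' := Nat.even_iff.1 he
  simp only [revTop, symbolB, oddHalves]
  rw [shifted_cons, List.filter_cons_of_neg (by simp [he'])]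

theorem revBottom_cons_of_even (h : (x :: t).Pairwise (· ≥ ·)) (he : Even (x + t.length)) :
    revBottom (x :: t) = (((x + t.length) / 2 : ℕ) - (revBottom t).length : ℤ) :: revBottom t := by
  have h1 := (pairwise_shifted h).filter fun x => decide (x % 2 = 0)
  have h2 := (pairwise_shifted h.of_cons).filter fun x => decide (x % 2 = 0)
  have he' := Nat.even_iff.1 he
  simp only [revBottom, symbolB, evenHalves]
  rw [insertionSort_map_half_eq_reverse h1, insertionSort_map_half_eq_reverse h2, shifted_cons,
    List.filter_cons_of_pos (by simpa using he'), List.map_cons, List.reverse_cons,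
    unshift_append_singleton]
  simp [length_unshift]

theorem revBottom_cons_of_odd (ho : Odd (x + t.length)) :
    revBottom (x :: t) = revBottom t := by
  have ho' := Nat.odd_iff.1 ho
  simp only [revBottom, symbolB, evenHalves]
  rw [shifted_cons, List.filter_cons_of_neg (by simp [ho'])]

end Cons

/-- Every term of a decreasing sequence contributes to one row of the symbol. -/
theorem length_revTop_add_length_revBottom (a : List ℕ) :
    (revTop a).length + (revBottom a).length = a.length := by
  rw [← length_shifted a]
  simp only [revTop, revBottom, symbolB, List.length_reverse, length_unshift, oddHalves, evenHalves,
    List.length_insertionSort, List.length_map]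
  induction shifted a with
  | nil => rfl
  | cons x t ih =>
    rcases Nat.mod_two_eq_zero_or_one x with h | h <;> simp [h] <;> omega

/-! ### Sequences whose terms of one parity come in pairs -/

/-- A decreasing sequence in which the terms `a i` with `a i + κ` odd come in pairs of equal
neighbours: an even number of them lies above each descent. -/
structure IsPaired (κ : ℕ) (a : ℕ → ℕ) : Prop where
  antitone : Antitone a
  even_sum : ∀ i, a (i + 1) < a i → Even (∑ j ∈ range (i + 1), (a j + κ))

/-- `-1` at the first term of each pair, `1` at the second one, and `0` at the unpaired terms. -/
def pairSign (κ : ℕ) (a : ℕ → ℕ) (i : ℕ) : ℤ :=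
  if Odd (a i + κ) then (-1) ^ (∑ j ∈ range (i + 1), (a j + κ)) else 0

section pairSign

variable {κ : ℕ} {a : ℕ → ℕ}

theorem pairSign_of_even {i : ℕ} (h : Even (a i + κ)) : pairSign κ a i = 0 := by
  simp [pairSign, Nat.not_odd_iff_even.2 h]

theorem pairSign_of_odd {i : ℕ} (h : Odd (a i + κ)) :
    pairSign κ a i = -(-1) ^ (∑ j ∈ range i, (a j + κ)) := by
  rw [pairSign, if_pos h, sum_range_succ, pow_add, h.neg_one_pow, mul_neg_one]

theorem pairSign_eq_neg_one_iff {i : ℕ} :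
    pairSign κ a i = -1 ↔ Odd (a i + κ) ∧ Even (∑ j ∈ range i, (a j + κ)) := by
  rcases Nat.even_or_odd (a i + κ) with h | h
  · simp [pairSign_of_even h, Nat.not_odd_iff_even.2 h]
  · rw [pairSign_of_odd h]
    simp [h, neg_one_pow_eq_one_iff_even]

theorem pairSign_eq_one_iff {i : ℕ} :
    pairSign κ a i = 1 ↔ Odd (a i + κ) ∧ Odd (∑ j ∈ range i, (a j + κ)) := by
  rcases Nat.even_or_odd (a i + κ) with h | h
  · simp [pairSign_of_even h, Nat.not_odd_iff_even.2 h]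
  · rw [pairSign_of_odd h]
    simp [h, neg_eq_iff_eq_neg, neg_one_pow_eq_neg_one_iff_odd]

theorem pairSign_cases (i : ℕ) :
    pairSign κ a i = 0 ∨ pairSign κ a i = -1 ∨ pairSign κ a i = 1 := by
  rcases Nat.even_or_odd (a i + κ) with h | h
  · exact Or.inl (pairSign_of_even h)
  · rw [pairSign, if_pos h]
    exact Or.inr (neg_one_pow_eq_or ℤ _).symm

theorem pairSign_eq_zero_iff {i : ℕ} : pairSign κ a i = 0 ↔ Even (a i + κ) := by
  refine ⟨fun h => ?_, pairSign_of_even⟩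
  by_contra h1
  rw [pairSign, if_pos (Nat.not_even_iff_odd.1 h1)] at h
  exact pow_ne_zero _ (by norm_num) h

namespace IsPaired

theorem eq_of_odd_sum (h : IsPaired κ a) {i : ℕ} (ho : Odd (∑ j ∈ range (i + 1), (a j + κ))) :
    a (i + 1) = a i :=
  le_antisymm (h.antitone (Nat.le_succ i))
    (not_lt.1 fun hlt => Nat.not_even_iff_odd.2 ho (h.even_sum i hlt))

/-- An unpaired term would leave the preceding sum odd, forcing equality with its predecessor, which
is of paired parity by induction. -/
theorem odd_of_odd_sum (h : IsPaired κ a) {i : ℕ} (ho : Odd (∑ j ∈ range (i + 1), (a j + κ))) :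
    Odd (a i + κ) := by
  induction i with
  | zero => simpa using ho
  | succ i ih =>
    by_contra h1
    have h2 : Odd (∑ j ∈ range (i + 1), (a j + κ)) := by
      rw [sum_range_succ] at ho
      exact (Nat.odd_add.1 ho).2 (Nat.not_odd_iff_even.1 h1)
    exact h1 (h.eq_of_odd_sum h2 ▸ ih h2)

theorem next (h : IsPaired κ a) {i : ℕ} (hi : pairSign κ a i = -1) :
    a (i + 1) = a i ∧ pairSign κ a (i + 1) = 1 := by
  rw [pairSign_eq_neg_one_iff] at hi
  have h1 : Odd (∑ j ∈ range (i + 1), (a j + κ)) := by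
    rw [sum_range_succ]
    exact hi.2.add_odd hi.1
  have h2 := h.eq_of_odd_sum h1
  exact ⟨h2, pairSign_eq_one_iff.2 ⟨h2 ▸ hi.1, h1⟩⟩

theorem prev (h : IsPaired κ a) {i : ℕ} (hi : pairSign κ a i = 1) :
    ∃ j, i = j + 1 ∧ pairSign κ a j = -1 ∧ a j = a i := by
  rw [pairSign_eq_one_iff] at hi
  rcases i with _ | j
  · simp at hi
  · refine ⟨j, rfl, pairSign_eq_neg_one_iff.2 ⟨h.odd_of_odd_sum hi.2, ?_⟩,
      (h.eq_of_odd_sum hi.2).symm⟩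
    have h1 := hi.2
    rw [sum_range_succ] at h1
    exact Nat.not_odd_iff_even.1 fun h2 =>
      Nat.not_even_iff_odd.2 (h.odd_of_odd_sum hi.2) ((Nat.odd_add.1 h1).1 h2)

end IsPaired

/-- The offset is added once in each sequence, so its total contribution is even. -/
theorem sign_add (κ : ℕ) (a b : ℕ → ℕ) (i : ℕ) : sign (fun i => a i + b i) i =
    (-1) ^ (∑ j ∈ range (i + 1), (a j + κ)) * (-1) ^ (∑ j ∈ range (i + 1), (b j + κ)) := by
  have h : (∑ j ∈ range (i + 1), (a j + κ)) + ∑ j ∈ range (i + 1), (b j + κ) =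
      (∑ j ∈ range (i + 1), (a j + b j)) + 2 * ((i + 1) * κ) := by
    simp only [sum_add_distrib, sum_const, card_range, smul_eq_mul]
    ring
  rw [← pow_add, h, pow_add, pow_mul]
  simp [sign]

theorem IsPaired.pow_sum_of_even (h : IsPaired κ a) {i : ℕ} (hi : Even (a i + κ)) :
    (-1 : ℤ) ^ (∑ j ∈ range (i + 1), (a j + κ)) = 1 :=
  Even.neg_one_pow (Nat.not_odd_iff_even.1 fun h1 =>
    Nat.not_even_iff_odd.2 (h.odd_of_odd_sum h1) hi)

theorem pow_sum_of_odd {i : ℕ} (hi : Odd (a i + κ)) :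
    (-1 : ℤ) ^ (∑ j ∈ range (i + 1), (a j + κ)) = pairSign κ a i := by
  rw [pairSign, if_pos hi]

variable {b : ℕ → ℕ}

/-- The sum of the pair signs is a correction of the sum of two sequences with pairs. -/
theorem IsPaired.isCorrection (ha : IsPaired κ a) (hb : IsPaired κ b) :
    IsCorrection (fun i => a i + b i) (fun i => pairSign κ a i + pairSign κ b i) where
  antitone := ha.antitone.add hb.antitone
  of_odd i hi := by
    -- Exactly one summand is of paired parity. The other factor is `1`, since no pair is open at an
    -- unpaired term.
    rw [sign_add κ]
    rcases Nat.even_or_odd (a i + κ) with h1 | h1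
    · have h2 : Odd (b i + κ) := by grind
      rw [ha.pow_sum_of_even h1, pow_sum_of_odd h2, pairSign_of_even h1]
      ring
    · have h2 : Even (b i + κ) := by grind
      rw [hb.pow_sum_of_even h2, pow_sum_of_odd h1, pairSign_of_even h2]
      ring
  of_even i hi := by
    have h3 : pairSign κ a i = 0 ↔ pairSign κ b i = 0 := by
      rw [pairSign_eq_zero_iff, pairSign_eq_zero_iff]
      grind
    have h1 := pairSign_cases (κ := κ) (a := a) i
    have h2 := pairSign_cases (κ := κ) (a := b) i
    omega
  next i hi := by
    have h1 := pairSign_cases (κ := κ) (a := a) i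
    have h2 := pairSign_cases (κ := κ) (a := b) i
    have h3 := ha.next (i := i) (by omega)
    have h4 := hb.next (i := i) (by omega)
    omega
  prev i hi := by
    have h1 := pairSign_cases (κ := κ) (a := a) i
    have h2 := pairSign_cases (κ := κ) (a := b) i
    obtain ⟨j, rfl, h3⟩ := ha.prev (i := i) (by omega)
    obtain ⟨k, hk, h4⟩ := hb.prev (i := j + 1) (by omega)
    obtain rfl : j = k := by omega
    exact ⟨j, rfl, by omega, by omega⟩

/-- An even sum has both summands paired or both unpaired. When both are paired, the product of
their marks is the sign, so the marks cancel exactly when it is `-1`. -/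
theorem pairSign_add_eq_zero_iff (i : ℕ)
    (hi : Even (a i + b i)) : pairSign κ a i + pairSign κ b i = 0 ↔
      sign (fun i => a i + b i) i = -1 ∨ Even (a i + κ) := by
  rw [sign_add κ]
  rcases Nat.even_or_odd (a i + κ) with h1 | h1
  · have h2 : Even (b i + κ) := by grind
    simp [pairSign_of_even h1, pairSign_of_even h2, h1]
  · have h2 : Odd (b i + κ) := by grind
    rw [pow_sum_of_odd h1, pow_sum_of_odd h2]
    have h3 := pairSign_cases (κ := κ) (a := a) i
    have h4 := pairSign_cases (κ := κ) (a := b) i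
    have h5 := mt pairSign_eq_zero_iff.1 (Nat.not_even_iff_odd.2 h1)
    have h6 := mt pairSign_eq_zero_iff.1 (Nat.not_even_iff_odd.2 h2)
    have h7 := Nat.not_even_iff_odd.2 h1
    rcases h3 with h3 | h3 | h3 <;> rcases h4 with h4 | h4 | h4 <;> simp_all

end pairSign

/-! ### The symbol in terms of pair signs -/

/-- Twice the entry of the symbol that belongs to the index `i`. -/
def height (κ : ℕ) (δ : ℤ) (a : ℕ → ℕ) (i : ℕ) : ℤ :=
  a i + pairSign κ a i + δ * (-1) ^ i

/-- The rows of the symbol of the terms with index at least `m` are given by `height`. -/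
structure SuffixFormula (κ : ℕ) (δ : ℤ) (l : List ℕ) (m : ℕ) : Prop where
  length : 2 * ((revTop (l.drop m)).length : ℤ) = l.length - m - δ - (m % 2 : ℕ)
  top : ∀ j, 2 * (revTop (l.drop m)).getD j 0 = height κ δ (l.getD · 0) (m + m % 2 + 2 * j)
  bottom : ∀ j, 2 * (revBottom (l.drop m)).getD j 0 =
    height κ δ (l.getD · 0) (m + (m + 1) % 2 + 2 * j)

namespace SuffixFormula

variable {κ : ℕ} {δ : ℤ} {l : List ℕ} {m : ℕ}

theorem drop_eq_cons (hm : m < l.length) : l.drop m = l.getD m 0 :: l.drop (m + 1) := by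
  rw [List.drop_eq_getElem_cons hm, List.getD_eq_getElem _ _ hm]

/-- By parity, an unpaired term at an even index enters the top row, one at an odd index the bottom
row. -/
theorem of_single (hl : l.Pairwise (· ≥ ·)) (hκ : Even (l.length + κ)) (hm : m < l.length)
    (hs : Even (l.getD m 0 + κ)) (h : SuffixFormula κ δ l (m + 1)) : SuffixFormula κ δ l m := by
  have hd := drop_eq_cons hm
  have hp : (l.getD m 0 :: l.drop (m + 1)).Pairwise (· ≥ ·) := hd ▸ hl.drop
  have hlen := length_revTop_add_length_revBottom (l.drop (m + 1))
  have hlen' : (l.drop (m + 1)).length = l.length - (m + 1) := List.length_drop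
  have hh : height κ δ (l.getD · 0) m = l.getD m 0 + δ * (-1) ^ m := by
    rw [height, pairSign_of_even (a := (l.getD · 0)) hs, add_zero]
  have h1 := h.length
  rcases Nat.even_or_odd m with he | ho
  · have hpar : Odd (l.getD m 0 + (l.drop (m + 1)).length) := by
      rw [hlen']
      grind
    rw [he.neg_one_pow] at hh
    have hm2 := Nat.even_iff.1 he
    have e1 := revTop_cons_of_odd hp hpar
    have e2 := revBottom_cons_of_odd hpar
    rw [← hd] at e1 e2
    have hpar' := Nat.odd_iff.1 hpar
    refine ⟨?_, fun j => ?_, fun j => ?_⟩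
    · rw [e1, List.length_cons]
      omega
    · rw [e1]
      rcases j with _ | j
      · rw [List.getD_cons_zero, show m + m % 2 + 2 * 0 = m by omega, hh]
        omega
      · rw [List.getD_cons_succ, h.top]
        congr 1
        omega
    · rw [e2, h.bottom]
      congr 1
      omega
  · have hpar : Even (l.getD m 0 + (l.drop (m + 1)).length) := by
      rw [hlen']
      grind
    rw [ho.neg_one_pow] at hh
    have hm2 := Nat.odd_iff.1 ho
    have e1 := revTop_cons_of_even hpar
    have e2 := revBottom_cons_of_even hp hpar
    rw [← hd] at e1 e2
    have hpar' := Nat.even_iff.1 hpar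
    refine ⟨?_, fun j => ?_, fun j => ?_⟩
    · rw [e1]
      omega
    · rw [e1, h.top]
      congr 1
      omega
    · rw [e2]
      rcases j with _ | j
      · rw [List.getD_cons_zero, show m + (m + 1) % 2 + 2 * 0 = m by omega, hh]
        omega
      · rw [List.getD_cons_succ, h.bottom]
        congr 1
        omega

/-- The two terms of a pair enter each other's rows: the entry for index `m` comes from the term at
`m + 1`, whose shift is one smaller, and conversely. The marks `-1` and `1` record this exchange. -/
theorem of_pair (hl : l.Pairwise (· ≥ ·)) (hκ : Even (l.length + κ)) (hm : m + 1 < l.length)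
    (hs : pairSign κ (l.getD · 0) m = -1) (hs' : pairSign κ (l.getD · 0) (m + 1) = 1)
    (heq : l.getD (m + 1) 0 = l.getD m 0)
    (h : SuffixFormula κ δ l (m + 2)) : SuffixFormula κ δ l m := by
  have hd := drop_eq_cons (Nat.lt_of_succ_lt hm)
  have hd' := drop_eq_cons hm
  rw [heq] at hd'
  have hp : (l.getD m 0 :: l.drop (m + 1)).Pairwise (· ≥ ·) := hd ▸ hl.drop
  have hp' : (l.getD m 0 :: l.drop (m + 2)).Pairwise (· ≥ ·) := hd' ▸ hl.drop
  have hlen := length_revTop_add_length_revBottom (l.drop (m + 2))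
  have hlen' : (l.drop (m + 1)).length = l.length - (m + 1) := List.length_drop
  have hlen2 : (l.drop (m + 2)).length = l.length - (m + 2) := List.length_drop
  have hh : height κ δ (l.getD · 0) m = l.getD m 0 - 1 + δ * (-1) ^ m := by
    rw [height, hs]
    ring
  have hh' : height κ δ (l.getD · 0) (m + 1) = l.getD m 0 + 1 - δ * (-1) ^ m := by
    rw [height, hs', heq, pow_succ]
    ring
  have hodd := (pairSign_eq_neg_one_iff.1 hs).1
  have h1 := h.length
  rcases Nat.even_or_odd m with he | ho
  · have hpar : Even (l.getD m 0 + (l.drop (m + 1)).length) := by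
      rw [hlen']
      grind
    have hpar2 : Odd (l.getD m 0 + (l.drop (m + 2)).length) := by
      rw [hlen2]
      grind
    rw [he.neg_one_pow] at hh hh'
    have hm2 := Nat.even_iff.1 he
    have e1 := revTop_cons_of_even hpar
    have e2 := revBottom_cons_of_even hp hpar
    have e3 := revTop_cons_of_odd hp' hpar2
    have e4 := revBottom_cons_of_odd hpar2
    rw [← hd] at e1 e2
    rw [← hd'] at e3 e4
    rw [e3] at e1
    rw [e4] at e2
    have hpar' := Nat.even_iff.1 hpar
    have hpar2' := Nat.odd_iff.1 hpar2
    refine ⟨?_, fun j => ?_, fun j => ?_⟩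
    · rw [e1, List.length_cons]
      omega
    · rw [e1]
      rcases j with _ | j
      · rw [List.getD_cons_zero, show m + m % 2 + 2 * 0 = m by omega, hh]
        omega
      · rw [List.getD_cons_succ, h.top]
        congr 1
        omega
    · rw [e2]
      rcases j with _ | j
      · rw [List.getD_cons_zero, show m + (m + 1) % 2 + 2 * 0 = m + 1 by omega, hh']
        omega
      · rw [List.getD_cons_succ, h.bottom]
        congr 1
        omega
  · have hpar : Odd (l.getD m 0 + (l.drop (m + 1)).length) := by
      rw [hlen']
      grind
    have hpar2 : Even (l.getD m 0 + (l.drop (m + 2)).length) := by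
      rw [hlen2]
      grind
    rw [ho.neg_one_pow] at hh hh'
    have hm2 := Nat.odd_iff.1 ho
    have e1 := revTop_cons_of_odd hp hpar
    have e2 := revBottom_cons_of_odd hpar
    have e3 := revTop_cons_of_even hpar2
    have e4 := revBottom_cons_of_even hp' hpar2
    rw [← hd] at e1 e2
    rw [← hd'] at e3 e4
    rw [e3] at e1
    rw [e4] at e2
    have hpar' := Nat.odd_iff.1 hpar
    have hpar2' := Nat.even_iff.1 hpar2
    refine ⟨?_, fun j => ?_, fun j => ?_⟩
    · rw [e1, List.length_cons]
      omega
    · rw [e1]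
      rcases j with _ | j
      · rw [List.getD_cons_zero, show m + m % 2 + 2 * 0 = m + 1 by omega, hh']
        omega
      · rw [List.getD_cons_succ, h.top]
        congr 1
        omega
    · rw [e2]
      rcases j with _ | j
      · rw [List.getD_cons_zero, show m + (m + 1) % 2 + 2 * 0 = m by omega, hh]
        omega
      · rw [List.getD_cons_succ, h.bottom]
        congr 1
        omega

/-- The formula for a suffix extends to the whole sequence. -/
theorem extend (hl : l.Pairwise (· ≥ ·)) (hκ : Even (l.length + κ))
    (hp : IsPaired κ (l.getD · 0)) (hm : m ≤ l.length)
    (he : Even (∑ j ∈ range m, (l.getD j 0 + κ))) (h : SuffixFormula κ δ l m) :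
    SuffixFormula κ δ l 0 := by
  induction m using Nat.strong_induction_on with
  | _ m ih =>
    rcases m with _ | m
    · exact h
    · by_cases h1 : Even (l.getD m 0 + κ)
      · refine ih m (by omega) (by omega) ?_ (h.of_single hl hκ (by omega) h1)
        rw [sum_range_succ] at he
        exact (Nat.even_add.1 he).2 h1
      · have h2 := Nat.not_even_iff_odd.1 h1
        have h3 : Odd (∑ j ∈ range m, (l.getD j 0 + κ)) := by
          rw [sum_range_succ] at he
          exact Nat.not_even_iff_odd.1 fun h3 => h1 ((Nat.even_add.1 he).1 h3)
        have h4 := (pairSign_eq_one_iff (a := (l.getD · 0))).2 ⟨h2, h3⟩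
        -- The last term of the prefix closes a pair, so the induction goes back by two indices.
        obtain ⟨j, rfl, h5, h6⟩ := hp.prev h4
        refine ih j (by omega) (by omega) (pairSign_eq_neg_one_iff.1 h5).2
          (h.of_pair hl hκ (by omega) h5 h4 h6.symm)

end SuffixFormula

/-! ### Partitions -/

section Partition

variable {N : ℕ} (p : Nat.Partition N)

theorem rows_pairwise : (rows p).Pairwise (· ≥ ·) :=
  Multiset.pairwise_sort _ _

theorem coe_rows : (rows p : Multiset ℕ) = p.parts :=
  Multiset.sort_eq _ _

theorem part_eq_getElem {i : ℕ} (h : i < (rows p).length) : part p i = (rows p)[i] :=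
  List.getD_eq_getElem _ _ h

theorem part_eq_zero {i : ℕ} (h : (rows p).length ≤ i) : part p i = 0 :=
  List.getD_eq_default _ _ h

theorem part_pos {i : ℕ} (h : i < (rows p).length) : 0 < part p i := by
  rw [part_eq_getElem p h]
  refine p.parts_pos ?_
  rw [← coe_rows, Multiset.mem_coe]
  exact List.getElem_mem h

theorem part_antitone : Antitone (part p) := by
  intro i j hij
  rcases lt_or_ge j (rows p).length with h | h
  · rw [part_eq_getElem p h, part_eq_getElem p (hij.trans_lt h)]
    rcases hij.eq_or_lt with rfl | hij
    · exact le_rfl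
    · exact List.pairwise_iff_getElem.1 (rows_pairwise p) i j _ h hij
  · simp [part_eq_zero p h]

theorem sum_part (κ : ℕ) {k : ℕ} (hk : k ≤ (rows p).length) :
    ∑ j ∈ range k, (part p j + κ) = (((rows p).take k).map (· + κ)).sum := by
  induction k with
  | zero => simp
  | succ k ih =>
    rw [sum_range_succ, ih (by omega), List.take_succ_eq_append_getElem hk, part_eq_getElem p hk,
      List.map_append, List.sum_append]
    simp

/-- A prefix ending at a descent contains every value with its full multiplicity; this turns even
multiplicities into even prefix sums. -/
theorem take_rows_eq_filter {i : ℕ} (h : part p (i + 1) < part p i) :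
    (rows p).take (i + 1) = (rows p).filter (part p (i + 1) < ·) := by
  conv_rhs => rw [← List.take_append_drop (i + 1) (rows p), List.filter_append]
  rw [List.filter_eq_self.2, List.filter_eq_nil_iff.2, List.append_nil]
  · intro a ha
    obtain ⟨j, hj, rfl⟩ := List.mem_drop_iff_getElem.1 ha
    rw [← part_eq_getElem]
    have := part_antitone p (Nat.le_add_right (i + 1) j)
    rw [add_comm j] at *
    simpa using this
  · intro a ha
    obtain ⟨j, hj, rfl⟩ := List.mem_take_iff_getElem.1 ha
    rw [← part_eq_getElem]
    have := part_antitone p (show j ≤ i by omega)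
    simpa using h.trans_le this

/-- `1` if the even parts come in pairs, `0` if the odd ones do. -/
def Theory.offset : Theory → ℕ
  | .B => 1
  | .C => 0
  | .D => 1

/-- The correction in `height` belonging to the symbol of each type. -/
def Theory.tilt : Theory → ℤ
  | .B => -1
  | .C => 0
  | .D => 1

variable {p} {t : Theory}

theorem IsTheoryPartition.even_count (h : IsTheoryPartition t p) {m : ℕ} (hm : Odd (m + t.offset)) :
    Even (p.parts.count m) := by
  cases t
  · exact h m (by simpa [Theory.offset, Nat.odd_add_one] using hm)
  · exact h m (by simpa [Theory.offset] using hm)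
  · exact h m (by simpa [Theory.offset, Nat.odd_add_one] using hm)

theorem IsTheoryPartition.isPaired (h : IsTheoryPartition t p) : IsPaired t.offset (part p) where
  antitone := part_antitone p
  even_sum i hi := by
    have hlt : i < (rows p).length := by
      by_contra h1
      rw [part_eq_zero p (not_lt.1 h1)] at hi
      omega
    rw [sum_part p _ hlt, take_rows_eq_filter p hi, ← Multiset.sum_coe, ← Multiset.map_coe,
      ← Multiset.filter_coe, coe_rows, sum_multiset_map_count]
    refine even_sum _ fun a ha => ?_
    rw [Multiset.mem_toFinset, Multiset.mem_filter] at ha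
    rw [Multiset.count_filter_of_pos (p := (part p (i + 1) < ·)) ha.2, smul_eq_mul]
    rcases Nat.even_or_odd (a + t.offset) with h1 | h1
    · exact h1.mul_left _
    · exact (h.even_count h1).mul_right _

theorem IsTheoryPartition.even_sum_length (h : IsTheoryPartition t p) :
    Even (∑ j ∈ range (rows p).length, (part p j + t.offset)) := by
  by_contra h1
  rw [Nat.not_even_iff_odd] at h1
  rcases hl : (rows p).length with _ | i
  · simp [hl] at h1
  -- An odd total would make the last positive part equal to the zero after it.
  · rw [hl] at h1
    have h2 := h.isPaired.eq_of_odd_sum h1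
    have h3 := part_pos p (i := i) (by omega)
    rw [part_eq_zero p hl.le] at h2
    omega

theorem sum_part_length (κ : ℕ) :
    ∑ j ∈ range (rows p).length, (part p j + κ) = N + (rows p).length * κ := by
  have h1 : ∑ j ∈ range (rows p).length, part p j = N := by
    have := sum_part p 0 le_rfl
    rw [List.take_length] at this
    simp only [add_zero, List.map_id'] at this
    rw [this, ← Multiset.sum_coe, coe_rows, p.parts_sum]
  simp [sum_add_distrib, h1]

theorem IsTheoryPartition.length_parity {k : ℕ} {p : Nat.Partition (t.boxes k)}
    (h : IsTheoryPartition t p) :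
    match t with
    | .B => Odd (rows p).length
    | .C => True
    | .D => Even (rows p).length := by
  have h1 := h.even_sum_length
  rw [sum_part_length] at h1
  cases t <;> simp only [Theory.boxes, Theory.offset] at h1 ⊢ <;> grind

/-- In types `B` and `D` the trailing zeros are of paired parity and carry alternating marks; `tilt`
is the constant that cancels them, given the parity of the length. In type `C` both corrections
vanish. -/
theorem IsTheoryPartition.height_eq_zero {k : ℕ} {p : Nat.Partition (t.boxes k)}
    (h : IsTheoryPartition t p) {i : ℕ} (hi : (rows p).length ≤ i) :
    height t.offset t.tilt (part p) i = 0 := by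
  obtain ⟨r, rfl⟩ := Nat.exists_eq_add_of_le hi
  have h1 := h.even_sum_length
  have h2 := part_eq_zero p hi
  have h3 : ∑ j ∈ range ((rows p).length + r), (part p j + t.offset) =
      ∑ j ∈ range (rows p).length, (part p j + t.offset) + r * t.offset := by
    rw [sum_range_add]
    simp [part_eq_zero p]
  have h4 := h.length_parity
  rcases t with _ | _ | _
  · have h5 : Odd (part p ((rows p).length + r) + Theory.B.offset) := by
      rw [h2]
      exact odd_one
    rw [height, pairSign_of_odd h5, h2, h3, pow_add, pow_add, h1.neg_one_pow,
      Odd.neg_one_pow h4]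
    simp [Theory.offset, Theory.tilt]
  · have h5 : Even (part p ((rows p).length + r) + Theory.C.offset) := by
      rw [h2]
      exact Even.zero
    rw [height, pairSign_of_even h5, h2]
    simp [Theory.tilt]
  · have h5 : Odd (part p ((rows p).length + r) + Theory.D.offset) := by
      rw [h2]
      exact odd_one
    rw [height, pairSign_of_odd h5, h2, h3, pow_add, pow_add, h1.neg_one_pow,
      Even.neg_one_pow h4]
    simp [Theory.offset, Theory.tilt]

/-! ### The symbol of a partition -/

theorem getD_rows_append_zero (i : ℕ) : (rows p ++ [0]).getD i 0 = part p i := by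
  rcases lt_or_ge i (rows p).length with h | h
  · rw [List.getD_append _ _ _ _ h, part]
  · rw [List.getD_append_right _ _ _ _ h, part_eq_zero p h]
    rcases i - (rows p).length with _ | j <;> simp

theorem rows_append_zero_pairwise : (rows p ++ [0]).Pairwise (· ≥ ·) := by
  rw [List.pairwise_append]
  exact ⟨rows_pairwise p, by simp, by simp⟩

variable {k : ℕ} {p : Nat.Partition (t.boxes k)}

theorem IsTheoryPartition.suffixFormula (h : IsTheoryPartition t p)
    (hl : ((rows p).length % 2 : ℕ) = -t.tilt) :
    SuffixFormula t.offset t.tilt (rows p) 0 := by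
  refine SuffixFormula.extend (m := (rows p).length) (rows_pairwise p) ?_ h.isPaired le_rfl
    h.even_sum_length ⟨?_, fun j => ?_, fun j => ?_⟩
  · cases t <;> simp only [Theory.offset, Theory.tilt] at hl ⊢ <;> grind
  · simp [revTop_nil, hl]
  · rw [List.drop_length, revTop_nil]
    exact (h.height_eq_zero (by omega)).symm
  · rw [List.drop_length, revBottom_nil]
    exact (h.height_eq_zero (by omega)).symm

theorem IsTheoryPartition.suffixFormula_append_zero (h : IsTheoryPartition t p)
    (hl : 1 - ((rows p).length % 2 : ℕ) = t.tilt) :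
    SuffixFormula t.offset t.tilt (rows p ++ [0]) 0 := by
  have hp : ((rows p ++ [0]).getD · 0) = part p := funext getD_rows_append_zero
  have e1 : revTop [0] = [] := by decide
  have e2 : revBottom [0] = [0] := by decide
  refine SuffixFormula.extend (m := (rows p).length) rows_append_zero_pairwise ?_
    (by rw [hp]; exact h.isPaired) (by simp) ?_ ⟨?_, fun j => ?_, fun j => ?_⟩
  · rw [List.length_append, List.length_singleton]
    cases t <;> simp only [Theory.offset, Theory.tilt] at hl ⊢ <;> grind
  · simpa only [getD_rows_append_zero] using h.even_sum_length
  · simp [e1, ← hl]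
  · rw [List.drop_left, e1, hp]
    exact (h.height_eq_zero (by omega)).symm
  · rw [List.drop_left, e2, hp, h.height_eq_zero (by omega)]
    rcases j with _ | j <;> simp

theorem getD_reverse_drop {l : List ℤ} {r : ℕ} (h : ∀ j, l.length - r ≤ j → l.reverse.getD j 0 = 0)
    (j : ℕ) : (l.drop r).reverse.getD j 0 = l.reverse.getD j 0 := by
  rw [List.reverse_drop]
  rcases lt_or_ge j (l.length - r) with h1 | h1
  · rw [List.getD_eq_getElem?_getD, List.getD_eq_getElem?_getD, List.getElem?_take_of_lt h1]
  · rw [h j h1]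
    exact List.getD_eq_default _ _ (by simp [h1])

/-- The entries of the symbol of a rigid partition, read from the right. -/
theorem IsRigid.symbol_formula (h : IsRigid t p) (j : ℕ) :
    2 * (partitionSymbol t p).top.reverse.getD j 0 =
        height t.offset t.tilt (part p) (2 * j) ∧
      2 * (partitionSymbol t p).bottom.reverse.getD j 0 =
        height t.offset t.tilt (part p) (2 * j + 1) := by
  have ht := h.isTheoryPartition
  have hlen := ht.length_parity
  have hp : ((rows p ++ [0]).getD · 0) = part p := funext getD_rows_append_zero
  have hnorm (j : ℕ) : 0 + 0 % 2 + 2 * j = 2 * j ∧ 0 + (0 + 1) % 2 + 2 * j = 2 * j + 1 := by omega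
  rcases t with _ | _ | _
  · have hs := ht.suffixFormula (by rw [Nat.odd_iff.1 hlen]; rfl)
    have h1 := hs.top j
    have h2 := hs.bottom j
    rw [(hnorm j).1, List.drop_zero] at h1
    rw [(hnorm j).2, List.drop_zero] at h2
    exact ⟨h1, h2⟩
  · rcases Nat.even_or_odd (rows p).length with he | ho
    · have hs := ht.suffixFormula (by rw [Nat.even_iff.1 he]; rfl)
      have h1 := hs.top j
      have h2 := hs.bottom j
      rw [(hnorm j).1, List.drop_zero] at h1
      rw [(hnorm j).2, List.drop_zero] at h2
      simp only [partitionSymbol, symbolC, if_pos he]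
      refine ⟨?_, h2⟩
      refine Eq.trans ?_ h1
      rw [List.reverse_cons]
      rcases lt_or_ge j (symbolB (rows p)).top.reverse.length with h3 | h3
      · rw [List.getD_append _ _ _ _ h3, revTop]
      · rw [List.getD_append_right _ _ _ _ h3, revTop, List.getD_eq_default _ _ h3]
        -- Read from the right, the extra `0` coincides with the default value.
        rcases j - _ with _ | j <;> simp
    · have hs := ht.suffixFormula_append_zero (by rw [Nat.odd_iff.1 ho]; rfl)
      have h1 := hs.top
      have h2 := hs.bottom
      have h3 := hs.length
      have h4 := length_revTop_add_length_revBottom (rows p ++ [0])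
      simp only [hnorm, List.drop_zero, hp] at h1 h2 h3
      simp only [partitionSymbol, symbolC, if_neg (Nat.not_even_iff_odd.2 ho)]
      refine ⟨h1 j, ?_⟩
      rw [getD_reverse_drop]
      · exact h2 j
      · intro i hi
        have h5 := h2 i
        rw [ht.height_eq_zero] at h5
        · exact (mul_eq_zero.1 h5).resolve_left two_ne_zero
        · rw [← List.length_reverse, ← revBottom] at hi
          simp [Theory.tilt] at h3 h4
          omega
  · have hs := ht.suffixFormula_append_zero (by rw [Nat.even_iff.1 hlen]; rfl)
    have h1 := hs.top
    have h2 := hs.bottom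
    have h3 := hs.length
    have h4 := length_revTop_add_length_revBottom (rows p ++ [0])
    simp only [hnorm, List.drop_zero, hp] at h1 h2 h3
    refine ⟨h1 j, ?_⟩
    simp only [partitionSymbol, symbolD]
    rw [getD_reverse_drop]
    · exact h2 j
    · intro i hi
      have h5 := h2 i
      rw [← List.length_reverse, ← revBottom] at hi
      simp [Theory.tilt] at h3 h4
      -- One deleted entry may belong to the last positive part. Absence of gaps makes that part
      -- `1`, an unpaired term at an odd index, so its height is `1 - 1 = 0`.
      have h6 : height Theory.D.offset Theory.D.tilt (part p) (2 * i + 1) = 0 := by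
        rcases le_or_gt (rows p).length (2 * i + 1) with h6 | h6
        · exact ht.height_eq_zero h6
        · have h7 : part p (2 * i + 1) = 1 := by
            have h8 := part_pos p h6
            have h9 := h.no_gaps (2 * i + 1)
            rw [part_eq_zero p (i := 2 * i + 1 + 1) (by omega)] at h9
            omega
          have h8 : Even (part p (2 * i + 1) + Theory.D.offset) := by
            rw [h7]
            exact even_two
          rw [height, pairSign_of_even h8, h7, pow_succ, pow_mul]
          simp [Theory.tilt]
      rw [h6] at h5
      exact (mul_eq_zero.1 h5).resolve_left two_ne_zero

end Partition

/-! ### Rigid semisimple operators -/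

theorem getD_reverse_leftpad (a : List ℤ) (n j : ℕ) :
    (a.leftpad n 0).reverse.getD j 0 = a.reverse.getD j 0 := by
  rw [List.leftpad, List.reverse_append, List.reverse_replicate]
  rcases lt_or_ge j a.reverse.length with h | h
  · rw [List.getD_append _ _ _ _ h]
  · rw [List.getD_append_right _ _ _ _ h, List.getD_eq_default _ _ h]
    simp [List.getD_eq_getElem?_getD, List.getElem?_replicate]
    split_ifs <;> rfl

theorem getD_reverse_addRight (a b : List ℤ) (j : ℕ) :
    (addRight a b).reverse.getD j 0 = a.reverse.getD j 0 + b.reverse.getD j 0 := by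
  rw [← getD_reverse_leftpad a (max a.length b.length) j,
    ← getD_reverse_leftpad b (max a.length b.length) j, addRight]
  have hl : (a.leftpad (max a.length b.length) 0).length =
      (b.leftpad (max a.length b.length) 0).length := by
    simp [List.leftpad]
  generalize a.leftpad (max a.length b.length) 0 = a' at *
  generalize b.leftpad (max a.length b.length) 0 = b' at *
  rw [List.reverse_zipWith hl]
  have hl' : a'.reverse.length = b'.reverse.length := by simpa using hl
  rcases lt_or_ge j a'.reverse.length with h | h
  · rw [List.getD_eq_getElem _ _ h, List.getD_eq_getElem _ _ (h.trans_eq hl'),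
      List.getD_eq_getElem _ _ (by simp at h hl ⊢; omega), List.getElem_zipWith]
  · rw [List.getD_eq_default _ _ h, List.getD_eq_default _ _ (hl'.symm.le.trans h),
      List.getD_eq_default _ _ (by simp at h hl ⊢; omega), add_zero]

namespace RigidSemisimpleOperator

variable {t : Theory} {n : ℕ}

/-- The parts of the sum of the two partitions, corrected by the pair signs. -/
def heights (x : RigidSemisimpleOperator t n) (i : ℕ) : ℤ :=
  x.sumPart i + (pairSign t.offset (part x.fst) i + pairSign t.offset (part x.snd) i)

theorem offset_second (t : Theory) : t.second.offset = t.offset := by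
  cases t <;> rfl

theorem isPaired_fst (x : RigidSemisimpleOperator t n) : IsPaired t.offset (part x.fst) :=
  x.fst_rigid.isTheoryPartition.isPaired

theorem isPaired_snd (x : RigidSemisimpleOperator t n) : IsPaired t.offset (part x.snd) :=
  offset_second t ▸ x.snd_rigid.isTheoryPartition.isPaired

theorem isCorrection (x : RigidSemisimpleOperator t n) : IsCorrection x.sumPart
    fun i => pairSign t.offset (part x.fst) i + pairSign t.offset (part x.snd) i :=
  x.isPaired_fst.isCorrection x.isPaired_snd

/-- The heights are determined by the symbol. -/
theorem heights_eq (x : RigidSemisimpleOperator t n) (i : ℕ) :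
    x.heights i = 2 * (if Even i then x.symbol.top.reverse.getD (i / 2) 0
      else x.symbol.bottom.reverse.getD (i / 2) 0) - (t.tilt + t.second.tilt) * (-1) ^ i := by
  have h1 := x.fst_rigid.symbol_formula (i / 2)
  have h2 := x.snd_rigid.symbol_formula (i / 2)
  rw [offset_second] at h2
  simp only [symbol, getD_reverse_addRight]
  rcases Nat.even_or_odd i with h | h
  · rw [if_pos h, mul_add, h1.1, h2.1, Nat.two_mul_div_two_of_even h]
    simp only [height, heights, sumPart]
    push_cast
    ring
  · rw [if_neg (Nat.not_even_iff_odd.2 h), mul_add, h1.2, h2.2,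
      Nat.two_mul_div_two_add_one_of_odd h]
    simp only [height, heights, sumPart]
    push_cast
    ring

theorem mu_eq (x : RigidSemisimpleOperator t n) (i : ℕ) : (x.mu i : ℤ) = meanMap x.heights i :=
  x.isCorrection.spMap_eq i

theorem parityCondition_iff (x : RigidSemisimpleOperator t n) (i : ℕ) :
    x.parityCondition i ↔ Even (part x.fst i + t.offset) := by
  cases t <;> simp [parityCondition, Theory.offset, Nat.even_add_one]

theorem condition_iff (x : RigidSemisimpleOperator t n) {i : ℕ} (h : Even (x.mu i)) :
    x.condition i ↔ IsIsolated x.heights i := by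
  refine x.isCorrection.condition_iff (fun j hj => ?_) h
  rw [parityCondition_iff]
  exact pairSign_add_eq_zero_iff j hj

theorem mu_eq_zero (x : RigidSemisimpleOperator t n) {i : ℕ} (h : x.length ≤ i) : x.mu i = 0 := by
  have h1 : x.sumPart i = 0 := by
    rw [sumPart, part_eq_zero _ ((le_max_left _ _).trans h),
      part_eq_zero _ ((le_max_right _ _).trans h)]
  simp [mu, spMap, h1]

theorem muParts_eq (x : RigidSemisimpleOperator t n) {k : ℕ} (h : x.length ≤ k) :
    x.muParts = ((Multiset.range k).map x.mu).filter fun a => 0 < a := by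
  obtain ⟨r, rfl⟩ := Nat.exists_eq_add_of_le h
  rw [muParts, Multiset.range_add, Multiset.map_add, Multiset.filter_add]
  refine (add_eq_left.2 (Multiset.filter_eq_nil.2 fun a ha => ?_)).symm
  rw [Multiset.map_map, Multiset.mem_map] at ha
  obtain ⟨j, -, rfl⟩ := ha
  simp [x.mu_eq_zero (Nat.le_add_right x.length j)]

/-- Removes the bound by `length`, which the symbol is not shown to determine; a positive value of
`mu` occurs only below it. -/
theorem tau_eq (x : RigidSemisimpleOperator t n) {m : ℕ} (hm : 0 < m) :
    x.tau m = open scoped Classical in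
      if Even m ∧ ∃ i, x.mu i = m ∧ IsIsolated x.heights i then -1 else 1 := by
  classical
  rw [tau]
  congr 1
  refine propext (and_congr_right fun he => exists_congr fun i => ?_)
  constructor
  · rintro ⟨-, h1, h2⟩
    exact ⟨h1, (x.condition_iff (h1 ▸ he)).1 h2⟩
  · rintro ⟨h1, h2⟩
    refine ⟨not_le.1 fun h3 => ?_, h1, (x.condition_iff (h1 ▸ he)).2 h2⟩
    rw [x.mu_eq_zero h3] at h1
    omega

/-- The symbol determines the fingerprint. -/
theorem fingerprint_eq_of_symbol_eq {x y : RigidSemisimpleOperator t n}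
    (h : x.symbol = y.symbol) : x.fingerprint = y.fingerprint := by
  have hu : x.heights = y.heights := by
    funext i
    rw [x.heights_eq, y.heights_eq, h]
  have hmu : x.mu = y.mu := by
    funext i
    have := x.mu_eq i
    rw [hu, ← y.mu_eq i] at this
    exact_mod_cast this
  have hparts : x.muParts = y.muParts := by
    -- The maximum of the two lengths is a common range; the extra terms are zeros and are filtered
    -- out.
    rw [x.muParts_eq (le_max_left _ y.length), y.muParts_eq (le_max_right x.length _), hmu]
  have htau : ∀ m ∈ y.muParts, x.tau m = y.tau m := by
    intro m hm
    have hpos : 0 < m := (Multiset.mem_filter.1 hm).2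
    rw [x.tau_eq hpos, y.tau_eq hpos, hu, hmu]
  have halpha : x.alpha = y.alpha := by
    simp only [alpha, hparts]
    rw [Finset.filter_congr fun m hm => by rw [htau m (Multiset.mem_toFinset.1 hm)]]
  have hbeta : x.beta = y.beta := by
    simp only [beta, hparts]
    rw [Multiset.filter_congr fun m hm => by rw [htau m hm]]
  exact Prod.ext halpha hbeta

end RigidSemisimpleOperator

end RigidOp

theorem mainTheorem1 (t : RigidOp.Theory) (n : ℕ) (x y : RigidOp.RigidSemisimpleOperator t n)
    (h : x.symbol = y.symbol) : x.fingerprint = y.fingerprint :=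
  RigidOp.RigidSemisimpleOperator.fingerprint_eq_of_symbol_eq h
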